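/- Let $X$ be a second countable locally compact (Hausdorff) Abelian group, written additively, and let $Y$ be its character group, with $(x,y)$ the value of $y\in Y$ at $x\in X$. The characteristic function of a probability distribution $\mu$ on $X$ is $\widehat\mu(y)=\int_X (x,y)\,d\mu(x)$, $y\in Y$. A distribution $\mu$ is called Gaussian if $\widehat\mu(y)=(x,y)\exp\{-\varphi(y)\}$ for some $x\in X$ and some continuous nonnegative function $\varphi$ on $Y$ with $\varphi(u+v)+\varphi(u-v)=2[\varphi(u)+\varphi(v)]$ for all $u,v\in Y$ (degenerate distributions are thus Gaussian). An integer $a$ is called admissible for $X$ if $aX=\{ax: x\in X\}\neq\{0\}$. Suppose that $X$ is not torsion-free and that there is no prime $p$ with $px=0$ for all $x\in X$. Then for every $n\ge 2$ there exist independent random variables $\xi_1,\dots,\xi_n$ with values in $X$, whose distributions $\mu_{\xi_j}$ have non-vanishing characteristic functions, and integers $a_j,b_j,c_j,d_j$ $(j=1,\dots,n)$ such that, for the linear forms $$L_1=\sum_{j=1}^n a_j\xi_j,\quad L_2=\sum_{j=1}^n b_j\xi_j,\quad L_3=\sum_{j=1}^n c_j\xi_j,\quad L_4=\sum_{j=1}^n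 d_j\xi_j,$$ the random vectors $(L_1,L_2)$ and $(L_3,L_4)$ are identically distributed; the condition $$(*)\qquad a_id_j-b_ic_j \text{ is admissible for } X \text{ for all } j=1,\dots,n$$ holds for every $i=1,\dots,n$; and for every $i$ satisfying $(*)$ the distribution $\mu_{\xi_i}$ is not Gaussian. Moreover, they can be chosen so that, for some prime $p$, all $\xi_j$ take values in one subgroup of $X$ isomorphic to $\mathbb{Z}(p)$, the cyclic group of order $p$, and $a_j=b_j=c_j=1$, $d_j=1-p$ for all $j$. -/

import Mathlib

open MeasureTheory ProbabilityTheory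

noncomputable section

namespace LCA

/-- The character group `Y = X^*` of an additively written topological Abelian group `X`: the
continuous homomorphisms from `X` to the unit circle, with the compact-open topology.
The group operation of `Y` is written multiplicatively. -/
abbrev CharGroup (X : Type*) [AddCommGroup X] [TopologicalSpace X] : Type _ :=
  PontryaginDual (Multiplicative X)

/-- The value `(x, y)` of the character `y` at `x`, as a complex number. -/
def pairing {X : Type*} [AddCommGroup X] [TopologicalSpace X] (x : X) (y : CharGroup X) : ℂ :=
  (y (Multiplicative.ofAdd x) : ℂ)

/-- The characteristic function `y ↦ ∫ (x, y) dμ(x)` of a distribution `μ` on `X`. -/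
def charFn {X : Type*} [AddCommGroup X] [TopologicalSpace X] [MeasurableSpace X]
    (μ : Measure X) (y : CharGroup X) : ℂ :=
  ∫ x, pairing x y ∂μ

/-- `μ` is a Gaussian distribution on `X`: its characteristic function is
`(x, y) exp(-φ(y))` with `x ∈ X` and `φ` continuous, nonnegative, and satisfying
`φ(u + v) + φ(u - v) = 2 (φ(u) + φ(v))` on the character group. Degenerate distributions
(`φ = 0`) are included. -/
def IsGaussianDistribution {X : Type*} [AddCommGroup X] [TopologicalSpace X] [MeasurableSpace X]
    (μ : Measure X) : Prop :=
  IsProbabilityMeasure μ ∧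
    ∃ (x : X) (φ : CharGroup X → ℝ), Continuous φ ∧ (∀ y, 0 ≤ φ y) ∧
      (∀ u v, φ (u * v) + φ (u / v) = 2 * (φ u + φ v)) ∧
      ∀ y, charFn μ y = pairing x y * (Real.exp (-φ y) : ℂ)

/-- The subgroup `X^(n) = {n x : x ∈ X}`. -/
def multiples (X : Type*) [AddCommGroup X] (n : ℤ) : AddSubgroup X :=
  (zsmulAddGroupHom n : X →+ X).range

/-- The subgroup `X_(n) = {x ∈ X : n x = 0}`. -/
def torsionPart (X : Type*) [AddCommGroup X] (n : ℤ) : AddSubgroup X :=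
  (zsmulAddGroupHom n : X →+ X).ker

/-- The integer `a` is admissible for `X` if `X^(a) ≠ {0}`. -/
def Admissible (X : Type*) [AddCommGroup X] (a : ℤ) : Prop :=
  multiples X a ≠ ⊥

/-- The linear form `a_1 ξ_1 + ⋯ + a_n ξ_n` with integer coefficients. -/
def linForm {X Ω : Type*} [AddCommGroup X] {n : ℕ} (a : Fin n → ℤ) (ξ : Fin n → Ω → X)
    (ω : Ω) : X :=
  ∑ j, a j • ξ j ω

end LCA

end

/-!
A group `X` with torsion contains an element `x₀` of prime order `p`. Take independent `ξ_j` with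
common law `(3/4) δ_0 + (1/4) δ_{x₀}`, carried by the subgroup of order `p` generated by `x₀`. The
coefficient `1 - p` acts on that subgroup as `1`, so the four linear forms coincide pointwise, while
every `a_i d_j - b_i c_j` equals `-p`, which is admissible because `p` does not annihilate `X`. The
characteristic function `3/4 + (1/4) (x₀, y)` has modulus at least `1/2`.

If this law were Gaussian with exponent `φ`, then `(x₀, y ^ p) = 1` would give `φ (y ^ p) = 0`;
since `φ (y ^ p) = p² φ y` (`quadratic_pow`), `φ` would vanish, the characteristic function would
have modulus one, and `(x₀, y) = 1` for every character `y`. This is impossible because the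
continuous characters of a locally compact Abelian group separate its points
(`exists_pairing_ne_one`).

The separation theorem is derived from Gelfand duality. Let `U` be the regular representation of `X`
on `L²(X)`, and let `T_f = ∫ f(x) U_x dx` for `f ∈ L¹(X)`. The operators `U_x` form a commuting
self-adjoint family, so their double commutant is a commutative C⋆-algebra, and it contains every
`T_f`. As `U_{x₀} ≠ 1`, some `f` has `T_f (U_{x₀} - 1) ≠ 0`, and a character `χ` of the algebra does
not vanish there. Then `x ↦ χ(U_x)` is a character of `X` nontrivial at `x₀`. It is continuous
because `χ(U_x) χ(T_f) = χ(U_x T_f)`, where `χ(T_f) ≠ 0` and `x ↦ U_x T_f` is norm continuous,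
although `x ↦ U_x` in general is not (`exists_char_of_unitary_rep`).
-/

open Filter Topology WeakDual
open scoped ENNReal

/-! ### Group characters from Gelfand duality -/

/-- The characters of a commutative closed star subalgebra of a C⋆-algebra separate its points: the
Gelfand transform is isometric. -/
theorem exists_character_ne_zero {A : Type*} [CStarAlgebra A] (B : StarSubalgebra ℂ A)
    (hB : IsClosed (B : Set A)) (hcomm : ∀ a ∈ B, ∀ b ∈ B, a * b = b * a) {a : A} (ha : a ∈ B)
    (ha0 : a ≠ 0) : ∃ χ : B →⋆ₐ[ℂ] ℂ, Continuous χ ∧ χ ⟨a, ha⟩ ≠ 0 := by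
  let : CommCStarAlgebra B :=
    { StarSubalgebra.cstarAlgebra B (h_closed := hB) with
      mul_comm := fun x y => Subtype.ext (hcomm x x.2 y y.2) }
  have hne : gelfandTransform ℂ B ⟨a, ha⟩ ≠ 0 := by
    rw [Ne, (injective_iff_map_eq_zero' (gelfandTransform ℂ B)).mp
      (gelfandTransform_isometry B).injective]
    exact fun h => ha0 (congrArg Subtype.val h)
  obtain ⟨χ, hχ⟩ : ∃ χ, gelfandTransform ℂ B ⟨a, ha⟩ χ ≠ 0 := by
    by_contra! h
    exact hne (ContinuousMap.ext h)
  refine ⟨⟨WeakDual.CharacterSpace.toAlgHom χ, fun b => ?_⟩, ?_, hχ⟩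
  · exact congrArg (fun f => f χ) (gelfandTransform_map_star b)
  · exact χ.1.continuous

/-- A unitary representation `U` of `X`, with no continuity assumed, yields a continuous character
of `X` nontrivial at `x₀` as soon as the double commutant of `U` contains an operator `T` for which
`x ↦ U x * T` is norm continuous and `T * (U x₀ - 1) ≠ 0`. -/
theorem exists_char_of_unitary_rep {X H : Type*} [AddCommGroup X] [TopologicalSpace X]
    [NormedAddCommGroup H] [InnerProductSpace ℂ H] [CompleteSpace H]
    (U : X → H →L[ℂ] H) (U_zero : U 0 = 1) (U_add : ∀ x y, U (x + y) = U x * U y)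
    (U_star : ∀ x, star (U x) = U (-x)) (T : H →L[ℂ] H)
    (hT : ∀ A : H →L[ℂ] H, (∀ x, A * U x = U x * A) → A * T = T * A)
    (hcont : Continuous fun x => U x * T) (x₀ : X) (hx₀ : T * (U x₀ - 1) ≠ 0) :
    ∃ y : LCA.CharGroup X, LCA.pairing x₀ y ≠ 1 := by
  let B : StarSubalgebra ℂ (H →L[ℂ] H) :=
    StarSubalgebra.centralizer ℂ (StarSubalgebra.centralizer ℂ (Set.range U) : Set (H →L[ℂ] H))
  have hstar : Set.range U ∪ star (Set.range U) = Set.range U := by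
    refine Set.union_eq_left.mpr ?_
    rintro a ⟨x, hx⟩
    exact ⟨-x, by rw [← U_star, hx, star_star]⟩
  have hBc : (B : Set (H →L[ℂ] H)) = (Set.range U).centralizer.centralizer := by
    rw [StarSubalgebra.coe_centralizer_centralizer, hstar]
  have hBclosed : IsClosed (B : Set (H →L[ℂ] H)) := by
    rw [hBc]; exact Set.isClosed_centralizer _
  have hBcomm : ∀ a ∈ B, ∀ b ∈ B, a * b = b * a := by
    intro a ha b hb
    rw [← SetLike.mem_coe, hBc] at ha hb
    refine Set.centralizer_centralizer_comm_of_comm ?_ a ha b hb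
    rintro _ ⟨x, rfl⟩ _ ⟨y, rfl⟩
    rw [← U_add, add_comm, U_add]
  have hU : ∀ x, U x ∈ B := by
    intro x
    rw [← SetLike.mem_coe, hBc]
    exact Set.subset_centralizer_centralizer ⟨x, rfl⟩
  have hTB : T ∈ B := by
    rw [← SetLike.mem_coe, hBc]
    intro A hA
    exact hT A fun x => (hA (U x) ⟨x, rfl⟩).symm
  obtain ⟨χ, hχc, hχ⟩ := exists_character_ne_zero B hBclosed hBcomm
    (mul_mem hTB (sub_mem (hU x₀) (one_mem B))) hx₀
  let u : X → B := fun x => ⟨U x, hU x⟩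
  let t : B := ⟨T, hTB⟩
  have hu0 : χ (u 0) = 1 := by
    rw [← map_one χ]; exact congrArg χ (Subtype.ext U_zero)
  have huadd : ∀ x y, χ (u (x + y)) = χ (u x) * χ (u y) := by
    intro x y
    rw [← map_mul]; exact congrArg χ (Subtype.ext (U_add x y))
  have hstarχ : ∀ x, χ (u (-x)) = star (χ (u x)) := by
    intro x
    rw [← map_star]; exact congrArg χ (Subtype.ext (U_star x).symm)
  have hprod : χ t * (χ (u x₀) - 1) ≠ 0 := by
    rw [← map_one χ, ← map_sub, ← map_mul]; exact hχ
  have hnorm : ∀ x, ‖χ (u x)‖ = 1 := by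
    intro x
    have h : χ (u x) * star (χ (u x)) = 1 := by
      rw [← hstarχ, ← huadd, add_neg_cancel, hu0]
    have h2 := congrArg norm h
    rw [norm_mul, norm_star, norm_one] at h2
    nlinarith [norm_nonneg (χ (u x))]
  -- Only `x ↦ U x * T` is norm continuous, so divide by `χ t ≠ 0`.
  have hχu : Continuous fun x => χ (u x) := by
    have h1 : Continuous fun x => χ (u x * t) := hχc.comp (hcont.subtype_mk _)
    have h2 : (fun x => χ (u x)) = fun x => χ (u x * t) / χ t := by
      funext x
      rw [map_mul, mul_div_cancel_right₀ _ (left_ne_zero_of_mul hprod)]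
    rw [h2]
    exact h1.div_const _
  let y : Multiplicative X →ₜ* Circle :=
    { toFun := fun x => ⟨χ (u x.toAdd), mem_sphere_zero_iff_norm.mpr (hnorm _)⟩
      map_one' := Subtype.ext hu0
      map_mul' := fun a b => Subtype.ext (huadd a.toAdd b.toAdd)
      continuous_toFun := (hχu.comp continuous_toAdd).subtype_mk _ }
  exact ⟨y, sub_ne_zero.mp (right_ne_zero_of_mul hprod)⟩

/-! ### The regular representation on `L²` -/

section RegularRepresentation

variable {X : Type*} [AddCommGroup X] [TopologicalSpace X] [IsTopologicalAddGroup X]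
  [MeasurableSpace X] [BorelSpace X] (μ : Measure X) [μ.IsAddLeftInvariant]

/-- Translation `f ↦ f (x + ·)` on `Lp`, as a linear isometry. -/
noncomputable def lpTranslate (p : ℝ≥0∞) [Fact (1 ≤ p)] (x : X) : Lp ℂ p μ →ₗᵢ[ℂ] Lp ℂ p μ :=
  Lp.compMeasurePreservingₗᵢ ℂ (x + ·) (measurePreserving_add_left μ x)

theorem lpTranslate_zero (p : ℝ≥0∞) [Fact (1 ≤ p)] (f : Lp ℂ p μ) :
    lpTranslate μ p 0 f = f := by
  refine Lp.ext ((Lp.coeFn_compMeasurePreserving f (measurePreserving_add_left μ 0)).trans ?_)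
  filter_upwards with z
  simp

theorem lpTranslate_add (p : ℝ≥0∞) [Fact (1 ≤ p)] (x y : X) (f : Lp ℂ p μ) :
    lpTranslate μ p (x + y) f = lpTranslate μ p x (lpTranslate μ p y f) := by
  have h := Lp.compMeasurePreserving_comp_apply f (measurePreserving_add_left μ y)
    (measurePreserving_add_left μ x)
  refine Eq.trans ?_ h
  have hfun : (fun z => x + y + z) = (y + ·) ∘ (x + ·) := by
    funext z
    simp only [Function.comp_apply]
    abel
  change Lp.compMeasurePreserving (fun z => x + y + z) _ f = _
  congr 2

theorem continuous_lpTranslate [LocallyCompactSpace X] [SecondCountableTopology X] [T2Space X]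
    [IsFiniteMeasureOnCompacts μ]
    (p : ℝ≥0∞) [Fact (1 ≤ p)] (hp : p ≠ ∞) (f : Lp ℂ p μ) :
    Continuous fun x => lpTranslate μ p x f := by
  let g : X → C(X, X) := (ContinuousMap.mk (fun a : X × X => a.1 + a.2) continuous_add).curry
  have hg : Continuous g := ContinuousMap.continuous _
  exact (continuous_const (y := f)).compMeasurePreservingLp hg
    (fun x => measurePreserving_add_left μ x) hp

/-- The regular representation of `X` on `L²(X)`, `(regularRep μ x h) z = h (x + z)`. -/
noncomputable def regularRep (x : X) : Lp ℂ 2 μ →L[ℂ] Lp ℂ 2 μ :=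
  (lpTranslate μ 2 x).toContinuousLinearMap

theorem norm_regularRep_apply (x : X) (h : Lp ℂ 2 μ) : ‖regularRep μ x h‖ = ‖h‖ :=
  (lpTranslate μ 2 x).norm_map h

theorem regularRep_zero : regularRep μ 0 = 1 :=
  ContinuousLinearMap.ext (lpTranslate_zero μ 2)

theorem regularRep_add (x y : X) : regularRep μ (x + y) = regularRep μ x * regularRep μ y :=
  ContinuousLinearMap.ext (lpTranslate_add μ 2 x y)

theorem star_regularRep (x : X) : star (regularRep μ x) = regularRep μ (-x) := by
  rw [ContinuousLinearMap.star_eq_adjoint]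
  symm
  rw [ContinuousLinearMap.eq_adjoint_iff]
  intro f g
  have h := (lpTranslate μ 2 x).inner_map_map (regularRep μ (-x) f) g
  rw [← h]
  congr 1
  change (regularRep μ x * regularRep μ (-x)) f = f
  rw [← regularRep_add, add_neg_cancel, regularRep_zero]
  rfl

/-- The regular representation is faithful: translation by `x₀ ≠ 0` moves the indicator of a small
neighbourhood of zero. -/
theorem regularRep_ne_one [T2Space X] [IsLocallyFiniteMeasure μ] [μ.IsOpenPosMeasure] {x₀ : X}
    (hx₀ : x₀ ≠ 0) : regularRep μ x₀ ≠ 1 := by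
  intro hone
  obtain ⟨s, hs0, hsμ⟩ := μ.exists_isOpen_measure_lt_top 0
  obtain ⟨u, v, huo, hvo, h0u, hxv, huv⟩ := t2_separation hx₀.symm
  let V : Set X := (s ∩ u) ∩ (x₀ + ·) ⁻¹' v
  have hVo : IsOpen V := (hsμ.1.inter huo).inter (hvo.preimage (continuous_const_add x₀))
  have hV0 : (0 : X) ∈ V := ⟨⟨hs0, h0u⟩, by simpa using hxv⟩
  have hVfin : μ V ≠ ∞ := ((measure_mono fun x hx => hx.1.1).trans_lt hsμ.2).ne
  have hind := indicatorConstLp_coeFn (p := 2) (hs := hVo.measurableSet) (hμs := hVfin)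
      (c := (1 : ℂ))
  have htr := Lp.coeFn_compMeasurePreserving
    (indicatorConstLp 2 hVo.measurableSet hVfin (1 : ℂ)) (measurePreserving_add_left μ x₀)
  have heq : Lp.compMeasurePreserving (x₀ + ·) (measurePreserving_add_left μ x₀)
      (indicatorConstLp 2 hVo.measurableSet hVfin (1 : ℂ)) =
      indicatorConstLp 2 hVo.measurableSet hVfin (1 : ℂ) :=
    DFunLike.congr_fun hone (indicatorConstLp 2 hVo.measurableSet hVfin (1 : ℂ))
  rw [heq] at htr
  have hnot : ∀ᵐ x ∂μ, x ∉ V := by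
    filter_upwards [hind, htr,
      (measurePreserving_add_left μ x₀).quasiMeasurePreserving.ae hind] with x h1 h2 h3 hxV
    have hx : x₀ + x ∉ V := fun h => Set.disjoint_left.mp huv h.1.2 hxV.2
    rw [h1, Function.comp_apply, h3, Set.indicator_of_mem hxV, Set.indicator_of_notMem hx] at h2
    exact one_ne_zero h2
  refine (hVo.measure_pos μ ⟨0, hV0⟩).ne' ?_
  simpa [ae_iff] using hnot

theorem norm_integral_smul_regularRep_le (f : Lp ℂ 1 μ) (h : Lp ℂ 2 μ) :
    ‖∫ x, f x • regularRep μ x h ∂μ‖ ≤ ‖f‖ * ‖h‖ := by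
  refine (norm_integral_le_integral_norm _).trans_eq ?_
  simp_rw [norm_smul, norm_regularRep_apply]
  rw [integral_mul_const, L1.norm_eq_integral_norm]

variable [LocallyCompactSpace X] [SecondCountableTopology X] [T2Space X]
    [IsFiniteMeasureOnCompacts μ]

theorem continuous_regularRep_apply (h : Lp ℂ 2 μ) : Continuous fun x => regularRep μ x h :=
  continuous_lpTranslate μ 2 (by simp) h

theorem integrable_smul_regularRep (f : Lp ℂ 1 μ) (h : Lp ℂ 2 μ) :
    Integrable (fun x => f x • regularRep μ x h) μ := by
  refine (L1.integrable_coeFn f).smul_bdd ‖h‖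
    (continuous_regularRep_apply μ h).aestronglyMeasurable ?_
  exact .of_forall fun x => (norm_regularRep_apply μ x h).le

/-- The integrated form `h ↦ ∫ f(x) U_x h dx` of the regular representation `U`, for `f ∈ L¹(X)`.
The integral is taken in `L²(X)` for each `h`, since `x ↦ U_x` need not be measurable in operator
norm. -/
noncomputable def convolutionOperator (f : Lp ℂ 1 μ) : Lp ℂ 2 μ →L[ℂ] Lp ℂ 2 μ :=
  LinearMap.mkContinuous
    { toFun := fun h => ∫ x, f x • regularRep μ x h ∂μ
      map_add' := fun h k => by
        simp_rw [map_add, smul_add]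
        exact integral_add (integrable_smul_regularRep μ f h) (integrable_smul_regularRep μ f k)
      map_smul' := fun c h => by
        simp_rw [map_smul, smul_comm _ c]
        exact integral_smul c _ }
    ‖f‖ (norm_integral_smul_regularRep_le μ f)

theorem convolutionOperator_apply (f : Lp ℂ 1 μ) (h : Lp ℂ 2 μ) :
    convolutionOperator μ f h = ∫ x, f x • regularRep μ x h ∂μ :=
  rfl

theorem convolutionOperator_sub (f g : Lp ℂ 1 μ) :
    convolutionOperator μ (f - g) = convolutionOperator μ f - convolutionOperator μ g := by
  ext1 h
  change _ = convolutionOperator μ f h - convolutionOperator μ g h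
  simp_rw [convolutionOperator_apply]
  rw [← integral_sub (integrable_smul_regularRep μ f h) (integrable_smul_regularRep μ g h)]
  refine integral_congr_ae ?_
  filter_upwards [Lp.coeFn_sub f g] with x hx
  rw [hx, Pi.sub_apply, sub_smul]

theorem continuous_convolutionOperator : Continuous (convolutionOperator μ) := by
  refine LipschitzWith.continuous (K := 1) (LipschitzWith.of_dist_le_mul fun f g => ?_)
  rw [dist_eq_norm, dist_eq_norm, NNReal.coe_one, one_mul, ← convolutionOperator_sub]
  exact LinearMap.mkContinuous_norm_le _ (norm_nonneg _) _

/-- The operators `convolutionOperator μ f` lie in the double commutant of the regular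
representation. -/
theorem commute_convolutionOperator (f : Lp ℂ 1 μ) (A : Lp ℂ 2 μ →L[ℂ] Lp ℂ 2 μ)
    (hA : ∀ x, A * regularRep μ x = regularRep μ x * A) :
    A * convolutionOperator μ f = convolutionOperator μ f * A := by
  ext1 h
  change A (convolutionOperator μ f h) = convolutionOperator μ f (A h)
  simp_rw [convolutionOperator_apply]
  rw [← A.integral_comp_comm (integrable_smul_regularRep μ f h)]
  refine integral_congr_ae (.of_forall fun x => ?_)
  simp only [map_smul]
  exact congrArg (f x • ·) (DFunLike.congr_fun (hA x) h)

theorem regularRep_mul_convolutionOperator (f : Lp ℂ 1 μ) (a : X) :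
    regularRep μ a * convolutionOperator μ f = convolutionOperator μ (lpTranslate μ 1 (-a) f) := by
  ext1 h
  change regularRep μ a (convolutionOperator μ f h) = _
  simp_rw [convolutionOperator_apply]
  rw [← (regularRep μ a).integral_comp_comm (integrable_smul_regularRep μ f h),
    ← integral_add_left_eq_self (fun x => lpTranslate μ 1 (-a) f x • regularRep μ x h) a]
  have hae : lpTranslate μ 1 (-a) f =ᵐ[μ] f ∘ (-a + ·) :=
    Lp.coeFn_compMeasurePreserving f (measurePreserving_add_left μ (-a))
  refine integral_congr_ae ?_
  filter_upwards [(measurePreserving_add_left μ a).quasiMeasurePreserving.ae hae] with x hx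
  rw [hx, map_smul, Function.comp_apply, neg_add_cancel_left, regularRep_add]
  rfl

/-- Multiplying by `convolutionOperator μ f` turns the strong continuity of the regular
representation into norm continuity, because translation is continuous on `L¹(X)`. -/
theorem continuous_regularRep_mul_convolutionOperator (f : Lp ℂ 1 μ) :
    Continuous fun a => regularRep μ a * convolutionOperator μ f := by
  simp_rw [regularRep_mul_convolutionOperator]
  exact (continuous_convolutionOperator μ).comp
    ((continuous_lpTranslate μ 1 (by simp) f).comp continuous_neg)

variable [μ.IsOpenPosMeasure]

/-- The operators `convolutionOperator μ f` have no common kernel. -/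
theorem exists_convolutionOperator_apply_ne_zero {h : Lp ℂ 2 μ} (hh : h ≠ 0) :
    ∃ f, convolutionOperator μ f h ≠ 0 := by
  have hpos : 0 < ‖h‖ := norm_pos_iff.mpr hh
  -- For `f` the indicator of a neighbourhood `V` on which `U_x h` stays within `‖h‖ / 2` of `h`,
  -- the integral of `U_x h` over `V` is too close to `μ(V) h` to vanish.
  have hnear : ∀ᶠ x in 𝓝 (0 : X), ‖regularRep μ x h - h‖ < ‖h‖ / 2 := by
    have hc : Continuous fun x => ‖regularRep μ x h - h‖ :=
      ((continuous_regularRep_apply μ h).sub continuous_const).norm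
    refine (hc.tendsto 0).eventually_lt_const ?_
    rw [regularRep_zero]
    simpa using hpos
  obtain ⟨s, hs0, hsμ⟩ := μ.exists_isOpen_measure_lt_top 0
  obtain ⟨V, hVsub, hVo, hV0⟩ := mem_nhds_iff.mp
    (inter_mem hnear (hsμ.1.mem_nhds hs0))
  have hVfin : μ V ≠ ∞ := ((measure_mono fun x hx => (hVsub hx).2).trans_lt hsμ.2).ne
  have hVpos : 0 < μ.real V :=
    ENNReal.toReal_pos (hVo.measure_pos μ ⟨0, hV0⟩).ne' hVfin
  refine ⟨indicatorConstLp 1 hVo.measurableSet hVfin (1 : ℂ), fun hzero => ?_⟩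
  have hT : ∫ x in V, regularRep μ x h ∂μ = 0 := by
    rw [← hzero, convolutionOperator_apply, ← integral_indicator hVo.measurableSet]
    refine integral_congr_ae ?_
    filter_upwards [indicatorConstLp_coeFn (p := 1) (hs := hVo.measurableSet) (hμs := hVfin)
      (c := (1 : ℂ))] with x hx
    rw [hx]
    by_cases hxV : x ∈ V <;> simp [hxV]
  have hint : IntegrableOn (fun x => regularRep μ x h) V μ := by
    refine IntegrableOn.of_bound hVfin.lt_top
      (continuous_regularRep_apply μ h).aestronglyMeasurable ‖h‖ ?_
    exact .of_forall fun x => (norm_regularRep_apply μ x h).le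
  have hdiff : ∫ x in V, (regularRep μ x h - h) ∂μ = -(μ.real V • h) := by
    rw [integral_sub hint (integrableOn_const hVfin), hT, setIntegral_const, zero_sub]
  have hle : ‖∫ x in V, (regularRep μ x h - h) ∂μ‖ ≤ ‖h‖ / 2 * μ.real V :=
    norm_setIntegral_le_of_norm_le_const hVfin.lt_top fun x hx => (hVsub hx).1.le
  rw [hdiff, norm_neg, norm_smul, Real.norm_of_nonneg hVpos.le] at hle
  nlinarith [mul_pos hVpos hpos]

end RegularRepresentation

/-! ### Separation of points by characters -/

/-- The continuous characters of a second countable locally compact Abelian group separate its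
points. -/
theorem exists_pairing_ne_one {X : Type*} [AddCommGroup X] [TopologicalSpace X]
    [IsTopologicalAddGroup X] [T2Space X] [LocallyCompactSpace X] [SecondCountableTopology X]
    {x₀ : X} (hx₀ : x₀ ≠ 0) : ∃ y : LCA.CharGroup X, LCA.pairing x₀ y ≠ 1 := by
  borelize X
  let μ : Measure X := Measure.addHaar
  obtain ⟨g, hg⟩ : ∃ g, (regularRep μ x₀ - 1) g ≠ 0 := by
    by_contra! h
    exact regularRep_ne_one μ hx₀ (sub_eq_zero.mp (ContinuousLinearMap.ext h))
  obtain ⟨f, hf⟩ := exists_convolutionOperator_apply_ne_zero μ hg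
  exact exists_char_of_unitary_rep (regularRep μ) (regularRep_zero μ) (regularRep_add μ)
    (star_regularRep μ) (convolutionOperator μ f) (commute_convolutionOperator μ f)
    (continuous_regularRep_mul_convolutionOperator μ f) x₀
    fun h => hf (DFunLike.congr_fun h g)

/-! ### The two-point distribution -/

theorem exists_prime_addOrderOf_eq {G : Type*} [AddCommGroup G] (hG : ¬ IsAddTorsionFree G) :
    ∃ (p : ℕ) (x : G), p.Prime ∧ addOrderOf x = p := by
  rw [isAddTorsionFree_iff_not_isOfFinAddOrder] at hG
  push Not at hG
  obtain ⟨x, hx0, hx⟩ := hG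
  have hne : addOrderOf x ≠ 1 := fun h => hx0 (AddMonoid.addOrderOf_eq_one_iff.mp h)
  exact ⟨(addOrderOf x).minFac, (addOrderOf x / (addOrderOf x).minFac) • x,
    Nat.minFac_prime hne,
    addOrderOf_nsmul_addOrderOf_sub hx.addOrderOf_pos.ne' (Nat.minFac_dvd _)⟩

/-- A solution of the parallelogram identity scales quadratically along powers. -/
theorem quadratic_pow {G : Type*} [CommGroup G] {φ : G → ℝ}
    (hφ : ∀ u v, φ (u * v) + φ (u / v) = 2 * (φ u + φ v)) (y : G) (k : ℕ) :
    φ (y ^ k) = (k : ℝ) ^ 2 * φ y := by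
  have h1 : φ 1 = 0 := by
    have h := hφ 1 1
    rw [mul_one, div_one] at h
    linarith
  induction k using Nat.twoStepInduction with
  | zero => simp [h1]
  | one => simp
  | more k ih0 ih1 =>
    have h := hφ (y ^ (k + 1)) y
    rw [← pow_succ, pow_succ y k, mul_div_cancel_right, ← pow_succ, ih0, ih1] at h
    push_cast at h ⊢
    linarith

section Pairing

variable {X : Type*} [AddCommGroup X] [TopologicalSpace X]

theorem norm_pairing (x : X) (y : LCA.CharGroup X) : ‖LCA.pairing x y‖ = 1 :=
  Circle.norm_coe _

theorem pairing_zero_left (y : LCA.CharGroup X) : LCA.pairing (0 : X) y = 1 := by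
  simp [LCA.pairing]

theorem pairing_pow (x : X) (y : LCA.CharGroup X) (k : ℕ) :
    LCA.pairing x (y ^ k) = LCA.pairing (k • x) y := by
  have h : (y ^ k) (Multiplicative.ofAdd x) = y (Multiplicative.ofAdd x) ^ k := by
    induction k with
    | zero => simp
    | succ k ih => rw [pow_succ, pow_succ, ← ih]; rfl
  rw [LCA.pairing, LCA.pairing, h, ofAdd_nsmul, map_pow]

end Pairing

/-- The law on `Bool` giving mass `3/4` to `false` and `1/4` to `true`; the masses differ so that the
characteristic function of an image supported on two points cannot vanish. -/
noncomputable def bernoulliQuarter : Measure Bool :=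
  (3 / 4 : ℝ≥0∞) • Measure.dirac false + (1 / 4 : ℝ≥0∞) • Measure.dirac true

instance : IsProbabilityMeasure bernoulliQuarter where
  measure_univ := by
    simp only [bernoulliQuarter, Measure.add_apply, Measure.smul_apply, measure_univ, smul_eq_mul,
      mul_one]
    rw [ENNReal.div_add_div_same]
    norm_num
    exact ENNReal.div_self (by simp) (by simp)

section TwoPoint

variable {X : Type*} [AddCommGroup X] [TopologicalSpace X] [T2Space X]
  [MeasurableSpace X] [BorelSpace X]

/-- The characteristic function of `(3/4) δ_0 + (1/4) δ_{x₀}`. -/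
theorem charFn_twoPoint (x₀ : X) (y : LCA.CharGroup X) :
    LCA.charFn (bernoulliQuarter.map fun b => if b then x₀ else 0) y =
      3 / 4 + 1 / 4 * LCA.pairing x₀ y := by
  have hm : Measurable fun b : Bool => if b then x₀ else (0 : X) := measurable_of_finite _
  have hi : ∀ x : X, Integrable (fun z => LCA.pairing z y) (Measure.dirac x) := fun x =>
    integrable_dirac (by simp)
  rw [LCA.charFn, bernoulliQuarter, Measure.map_add _ _ hm, Measure.map_smul, Measure.map_smul,
    Measure.map_dirac' hm, Measure.map_dirac' hm,
    integral_add_measure ((hi _).smul_measure (by finiteness))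
      ((hi _).smul_measure (by finiteness)),
    integral_smul_measure, integral_smul_measure, integral_dirac, integral_dirac]
  simp [pairing_zero_left]

theorem charFn_twoPoint_ne_zero (x₀ : X) (y : LCA.CharGroup X) :
    LCA.charFn (bernoulliQuarter.map fun b => if b then x₀ else 0) y ≠ 0 := by
  rw [charFn_twoPoint]
  intro h
  have h2 := congrArg norm (eq_neg_of_add_eq_zero_left h)
  rw [norm_neg, norm_mul, norm_pairing] at h2
  norm_num at h2

/-- A nonzero element of finite order cannot carry mass `1/4` of a Gaussian law with the rest at
zero: the exponent would vanish by quadratic scaling, forcing every character to be `1` at `x₀`. -/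
theorem not_isGaussianDistribution_twoPoint [IsTopologicalAddGroup X] [LocallyCompactSpace X]
    [SecondCountableTopology X] {x₀ : X} (hx₀ : x₀ ≠ 0) {p : ℕ} (hp : p ≠ 0)
    (hpx : p • x₀ = 0) :
    ¬ LCA.IsGaussianDistribution (bernoulliQuarter.map fun b => if b then x₀ else 0) := by
  rintro ⟨-, x, φ, -, -, hφ, hchar⟩
  have hnorm : ∀ y, ‖3 / 4 + 1 / 4 * LCA.pairing x₀ y‖ = Real.exp (-φ y) := by
    intro y
    rw [← charFn_twoPoint, hchar, norm_mul, norm_pairing, one_mul, Complex.norm_real,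
      Real.norm_of_nonneg (Real.exp_pos _).le]
  obtain ⟨y, hy⟩ := exists_pairing_ne_one hx₀
  have hφp : φ (y ^ p) = 0 := by
    have h := hnorm (y ^ p)
    rw [pairing_pow, hpx, pairing_zero_left] at h
    norm_num at h
    rwa [eq_comm, Real.exp_eq_one_iff, neg_eq_zero] at h
  have hφy : φ y = 0 := by
    rw [quadratic_pow hφ] at hφp
    exact (mul_eq_zero.mp hφp).resolve_left (by positivity)
  have h1 := hnorm y
  have h2 := norm_pairing x₀ y
  rw [hφy, neg_zero, Real.exp_zero] at h1
  refine hy ?_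
  generalize LCA.pairing x₀ y = z at h1 h2
  -- A proper convex combination of `1` and a unit `z` has modulus one only if `z = 1`.
  rw [← sq_eq_sq₀ (norm_nonneg _) zero_le_one, ← Complex.normSq_eq_norm_sq,
    Complex.normSq_apply] at h1 h2
  norm_num at h1 h2
  have hre : z.re = 1 := by nlinarith
  rw [hre] at h2
  have him : z.im = 0 := mul_self_eq_zero.mp (by linarith)
  exact Complex.ext hre him

end TwoPoint

/-! ### Construction of the random variables -/

theorem proposition1 {X : Type*} [AddCommGroup X] [TopologicalSpace X] [IsTopologicalAddGroup X]
    [T2Space X] [LocallyCompactSpace X] [SecondCountableTopology X]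
    [MeasurableSpace X] [BorelSpace X]
    (hX : ¬ IsAddTorsionFree X)
    (hXp : ∀ p : ℕ, p.Prime → LCA.torsionPart X p ≠ ⊤)
    (n : ℕ) (hn : 2 ≤ n) :
    ∃ (Ω : Type) (_ : MeasurableSpace Ω) (P : Measure Ω) (_ : IsProbabilityMeasure P)
      (ξ : Fin n → Ω → X) (a b c d : Fin n → ℤ),
      (∀ j, Measurable (ξ j)) ∧
      iIndepFun ξ P ∧
      (∀ j y, LCA.charFn (P.map (ξ j)) y ≠ 0) ∧
      IdentDistrib
        (fun ω => (LCA.linForm a ξ ω, LCA.linForm b ξ ω))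
        (fun ω => (LCA.linForm c ξ ω, LCA.linForm d ξ ω)) P P ∧
      (∀ i j, LCA.Admissible X (a i * d j - b i * c j)) ∧
      (∀ i, (∀ j, LCA.Admissible X (a i * d j - b i * c j)) →
        ¬ LCA.IsGaussianDistribution (P.map (ξ i))) ∧
      -- all the variables take values in one subgroup `ℤ(p)`, with explicit coefficients
      (∃ (p : ℕ) (K : AddSubgroup X), p.Prime ∧ Nonempty (K ≃+ ZMod p) ∧
        (∀ j ω, ξ j ω ∈ K) ∧
        ∀ j, a j = 1 ∧ b j = 1 ∧ c j = 1 ∧ d j = 1 - (p : ℤ)) := by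
  obtain ⟨p, x₀, hp, hord⟩ := exists_prime_addOrderOf_eq hX
  have hpx : p • x₀ = 0 := by rw [← hord, addOrderOf_nsmul_eq_zero]
  have hx₀ : x₀ ≠ 0 := by
    rintro rfl
    exact hp.one_lt.ne (by rw [← hord, addOrderOf_zero])
  let f : Bool → X := fun b => if b then x₀ else 0
  have hf : Measurable f := measurable_of_finite f
  let ξ : Fin n → (Fin n → Bool) → X := fun j ω => f (ω j)
  have hξ : ∀ j, Measurable (ξ j) := fun j => hf.comp (measurable_pi_apply j)
  have hmap : ∀ j, (Measure.pi fun _ : Fin n => bernoulliQuarter).map (ξ j) =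
      bernoulliQuarter.map f := by
    intro j
    conv_rhs => rw [← (measurePreserving_eval (fun _ : Fin n => bernoulliQuarter) j).map_eq]
    exact (Measure.map_map hf (measurable_pi_apply j)).symm
  have hadm : LCA.Admissible X (1 * (1 - (p : ℤ)) - 1 * 1) := by
    intro h
    refine hXp p hp (eq_top_iff.mpr fun x _ => ?_)
    have hx : (1 * (1 - (p : ℤ)) - 1 * 1) • x ∈ LCA.multiples X (1 * (1 - (p : ℤ)) - 1 * 1) :=
      ⟨x, rfl⟩
    rw [h, AddSubgroup.mem_bot, show (1 * (1 - (p : ℤ)) - 1 * 1) = -(p : ℤ) by ring, neg_smul,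
      neg_eq_zero] at hx
    exact hx
  have hK : ∀ b, f b ∈ AddSubgroup.zmultiples x₀ := by
    intro b
    cases b
    · exact zero_mem _
    · exact AddSubgroup.mem_zmultiples x₀
  have hforms : ∀ ω, LCA.linForm (fun _ => 1 - (p : ℤ)) ξ ω = LCA.linForm (fun _ => 1) ξ ω := by
    intro ω
    refine Finset.sum_congr rfl fun j _ => ?_
    rw [sub_smul, sub_eq_self, natCast_zsmul]
    change p • f (ω j) = 0
    cases ω j
    · exact smul_zero p
    · exact hpx
  have hlin : Measurable (LCA.linForm (fun _ => 1) ξ) :=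
    Finset.measurable_fun_sum _ fun j _ => (hξ j).const_smul (1 : ℤ)
  refine ⟨Fin n → Bool, inferInstance, Measure.pi fun _ => bernoulliQuarter, inferInstance, ξ,
    fun _ => 1, fun _ => 1, fun _ => 1, fun _ => 1 - (p : ℤ), hξ,
    iIndepFun_pi fun _ => hf.aemeasurable, fun j y => ?_, ?_, fun _ _ => hadm, fun i _ => ?_,
    p, AddSubgroup.zmultiples x₀, hp, ⟨?_⟩, fun j ω => hK (ω j),
    fun _ => ⟨rfl, rfl, rfl, rfl⟩⟩
  · rw [hmap]
    exact charFn_twoPoint_ne_zero x₀ y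
  · simp_rw [hforms]
    exact IdentDistrib.refl (hlin.prodMk hlin).aemeasurable
  · rw [hmap]
    exact not_isGaussianDistribution_twoPoint hx₀ hp.ne_zero hpx
  · exact (zmodAddEquivOfGenerator (g := ⟨x₀, AddSubgroup.mem_zmultiples x₀⟩)
      (fun x => by
        obtain ⟨k, hk⟩ := AddSubgroup.mem_zmultiples_iff.mp x.2
        exact ⟨k, Subtype.ext hk⟩)
      (by rw [Nat.card_zmultiples, hord])).symm
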